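/- Let $K$ be a nonempty perfect compact Hausdorff space, let $C(K)$ be the real Banach space of continuous functions $K\to\mathbb{R}$ with the supremum norm, and let $M(K)$ be the Banach space of Radon measures on $K$ (signed, countably additive, regular Borel measures) with the total variation norm, identified with $C(K)^*$ through $\mu(f)=\int_K f\,d\mu$. Let $T$ be a bounded linear operator on $C(K)$ whose adjoint has the form $T^*=g\,\mathrm{Id}+S$, that is, $T^*\mu=g\mu+S\mu$ for all $\mu\in M(K)$, where $g:K\to[0,\infty)$ is a Borel function that is integrable with respect to every Radon measure on $K$, $g\mu$ is the measure $E\mapsto\int_E g\,d\mu$, and $S$ is a weakly compact bounded linear operator on $M(K)$. Then the set $$\{x\in K : T^*(\delta_x)(\{x\})\ge 0\}$$ is dense in $K$, and $T$ satisfies the Daugavet equation $$\|\mathrm{Id}+T\|=1+\|T\|.$$ -/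

import Mathlib

open MeasureTheory Set Topology
open scoped NNReal ENNReal CompactlySupported

noncomputable section

namespace CKDual

section RadonMeasures

set_option linter.unusedSectionVars false

variable {K : Type*} [TopologicalSpace K] [CompactSpace K] [T2Space K]
  [MeasurableSpace K] [BorelSpace K]

instance signedMeasure_isFiniteMeasure_variation {X : Type*} [MeasurableSpace X]
    (μ : SignedMeasure X) : IsFiniteMeasure (VectorMeasure.variation μ) := by
  rw [← SignedMeasure.totalVariation_eq_variation]
  infer_instance

/-- A measure dominated by a finite regular measure is regular. -/
theorem regular_of_le {m n : Measure K} [IsFiniteMeasure m] (hm : m.Regular) (h : n ≤ m) :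
    n.Regular := by
  have : IsFiniteMeasure n := isFiniteMeasure_of_le m h
  have : n.InnerRegularCompactLTTop := by
    refine ⟨fun A hA r hr => ?_⟩
    obtain ⟨C, hCA, hC, hlt⟩ := hA.1.exists_isCompact_sdiff_lt (μ := m) (measure_ne_top m A)
      (ε := n A - r) (tsub_pos_of_lt hr).ne'
    refine ⟨C, hCA, hC, ?_⟩
    by_contra hcon
    push Not at hcon
    have h1 : n A ≤ n C + n (A \ C) := by
      calc n A = n (C ∪ A \ C) := by rw [union_sdiff_cancel hCA]
        _ ≤ _ := measure_union_le _ _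
    have h2 : n (A \ C) < n A - r := (h _).trans_lt hlt
    have h3 : n A - r ≤ n (A \ C) := by
      rw [tsub_le_iff_left]
      exact h1.trans (add_le_add hcon le_rfl)
    exact absurd h2 (not_lt.mpr h3)
  infer_instance

theorem regular_add {m n : Measure K} [IsFiniteMeasure m] [IsFiniteMeasure n]
    (hm : m.Regular) (hn : n.Regular) : (m + n).Regular := by
  infer_instance

variable (K) in
/-- The real vector space `M(K)` of Radon measures on `K`: the (finite, countably additive)
signed Borel measures on `K` whose total variation is a regular measure. -/
def radonMeasures : Submodule ℝ (SignedMeasure K) where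
  carrier := {μ | (VectorMeasure.variation μ).Regular}
  zero_mem' := by
    change (VectorMeasure.variation (0 : SignedMeasure K)).Regular
    rw [VectorMeasure.variation_zero]
    infer_instance
  add_mem' := by
    intro μ ν hμ hν
    exact regular_of_le (regular_add hμ hν) VectorMeasure.variation_add_le
  smul_mem' := by
    intro c μ hμ
    change (VectorMeasure.variation (c • μ)).Regular
    have : (VectorMeasure.variation μ).Regular := hμ
    rw [VectorMeasure.variation_smul]
    infer_instance

variable (K) in
/-- The space `M(K)` of Radon measures on the compact space `K`. -/
abbrev RadonMeasure : Type _ := ↥(radonMeasures K)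

namespace RadonMeasure

/-- The total variation norm `‖μ‖ = |μ|(K)`. -/
instance instNorm : Norm (RadonMeasure K) where
  norm μ := (VectorMeasure.variation (μ : SignedMeasure K)).real univ

theorem norm_def (μ : RadonMeasure K) :
    ‖μ‖ = (VectorMeasure.variation (μ : SignedMeasure K)).real univ := rfl

theorem normedSpaceCore : NormedSpace.Core ℝ (RadonMeasure K) where
  norm_nonneg _ := measureReal_nonneg
  norm_smul c μ := by
    simp only [norm_def, Submodule.coe_smul, VectorMeasure.variation_smul]
    simp [Measure.real]
  norm_triangle μ ν := by
    simp only [norm_def, Submodule.coe_add]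
    rw [← measureReal_add_apply]
    exact ENNReal.toReal_mono (measure_ne_top _ _) (VectorMeasure.variation_add_le univ)
  norm_eq_zero_iff μ := by
    simp only [norm_def]
    rw [measureReal_eq_zero_iff, Measure.measure_univ_eq_zero, VectorMeasure.variation_eq_zero]
    simp

instance instNormedAddCommGroup : NormedAddCommGroup (RadonMeasure K) :=
  fast_instance% NormedAddCommGroup.ofCore normedSpaceCore

instance instNormedSpace : NormedSpace ℝ (RadonMeasure K) :=
  fast_instance% NormedSpace.ofCore normedSpaceCore


/-- The duality `μ(f) = ∫ f dμ` between `M(K)` and `C(K)`. -/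
def pairing (μ : RadonMeasure K) (f : C(K, ℝ)) : ℝ :=
  ∫ᵛ x, f x ∂<•(μ : SignedMeasure K)

theorem integrable_continuous (μ : SignedMeasure K) (f : C(K, ℝ)) : μ.Integrable f :=
  f.continuous.integrable_of_hasCompactSupport (HasCompactSupport.of_compactSpace _)

/-- The functional on `C(K)` given by integration against a Radon measure. -/
def toDual : RadonMeasure K →ₗ[ℝ] StrongDual ℝ C(K, ℝ) where
  toFun μ := LinearMap.mkContinuous
    { toFun := fun f => pairing μ f
      map_add' := fun f g =>
        VectorMeasure.integral_fun_add (integrable_continuous _ f) (integrable_continuous _ g)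
      map_smul' := fun c f => VectorMeasure.integral_fun_smul _ _ c f }
    ((VectorMeasure.variation (μ : SignedMeasure K)).real univ) (by
      intro f
      have h := VectorMeasure.norm_integral_le_of_norm_le_const
        (μ := (μ : SignedMeasure K)) (B := (ContinuousLinearMap.lsmul ℝ ℝ).flip) (f := f)
        (C := ‖f‖) (Filter.Eventually.of_forall f.norm_coe_le_norm)
      rw [ContinuousLinearMap.opNorm_flip, ContinuousLinearMap.opNorm_lsmul, mul_one,
        mul_comm] at h
      exact h)
  map_add' μ ν := by
    ext f
    exact VectorMeasure.integral_add_vectorMeasure (integrable_continuous _ f)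
      (integrable_continuous _ f)
  map_smul' c μ := by
    ext f
    exact VectorMeasure.integral_smul_vectorMeasure f c

theorem toDual_apply (μ : RadonMeasure K) (f : C(K, ℝ)) :
    toDual μ f = ∫ᵛ x, f x ∂<•(μ : SignedMeasure K) := rfl

/-- The difference of two finite regular measures, as an element of `M(K)`. -/
def ofSub (m n : Measure K) [IsFiniteMeasure m] [IsFiniteMeasure n]
    (hm : m.Regular) (hn : n.Regular) : RadonMeasure K :=
  ⟨m.toSignedMeasure - n.toSignedMeasure, by
    refine regular_of_le (regular_add hm hn) (VectorMeasure.variation_sub_le.trans ?_)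
    simp⟩

theorem toDual_ofSub (m n : Measure K) [IsFiniteMeasure m] [IsFiniteMeasure n]
    (hm : m.Regular) (hn : n.Regular) (f : C(K, ℝ)) :
    toDual (ofSub m n hm hn) f = ∫ x, f x ∂m - ∫ x, f x ∂n := by
  rw [toDual_apply, ofSub, VectorMeasure.integral_sub_vectorMeasure
    (integrable_continuous _ f) (integrable_continuous _ f)]
  simp

theorem toDual_injective : Function.Injective (toDual (K := K)) := by
  rw [injective_iff_map_eq_zero]
  intro μ hμ
  set j := SignedMeasure.toJordanDecomposition (μ : SignedMeasure K) with hj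
  have hvar : (VectorMeasure.variation (μ : SignedMeasure K)) = j.posPart + j.negPart := by
    rw [← SignedMeasure.totalVariation_eq_variation]; rfl
  have hreg : (VectorMeasure.variation (μ : SignedMeasure K)).Regular := μ.2
  have h1 : j.posPart.Regular := regular_of_le hreg (hvar ▸ Measure.le_add_right le_rfl)
  have h2 : j.negPart.Regular := regular_of_le hreg (hvar ▸ Measure.le_add_left le_rfl)
  have hμ' : μ = ofSub j.posPart j.negPart h1 h2 :=
    Subtype.ext (SignedMeasure.toSignedMeasure_toJordanDecomposition _).symm
  have heq : j.posPart = j.negPart := by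
    refine Measure.ext_of_integral_eq_on_compactlySupported fun f => ?_
    have := congrArg (fun φ => φ f.toContinuousMap) hμ
    simp only [hμ', toDual_ofSub] at this
    exact sub_eq_zero.mp this
  apply Subtype.ext
  rw [hμ']
  ext s hs
  simp [ofSub, heq]

/-! ### Riesz representation: surjectivity -/

/-- The positive part of a functional, on non-negative functions. -/
def posFun (φ : StrongDual ℝ C(K, ℝ)) (f : C(K, ℝ)) : ℝ :=
  sSup (φ '' Icc 0 f)

theorem posFun_bddAbove (φ : StrongDual ℝ C(K, ℝ)) (f : C(K, ℝ)) :
    BddAbove (φ '' Icc 0 f) := by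
  refine ⟨‖φ‖ * ‖f‖, ?_⟩
  rintro _ ⟨g, hg, rfl⟩
  refine (le_abs_self _).trans ((φ.le_opNorm g).trans ?_)
  refine mul_le_mul_of_nonneg_left ?_ (norm_nonneg _)
  rw [ContinuousMap.norm_le _ (norm_nonneg _)]
  intro x
  have h1 : 0 ≤ g x := hg.1 x
  rw [Real.norm_eq_abs, abs_of_nonneg h1]
  have h2 : g x ≤ f x := hg.2 x
  exact h2.trans ((le_abs_self _).trans (f.norm_coe_le_norm x))

theorem le_posFun (φ : StrongDual ℝ C(K, ℝ)) {f g : C(K, ℝ)} (h0 : 0 ≤ g) (h : g ≤ f) :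
    φ g ≤ posFun φ f :=
  le_csSup (posFun_bddAbove φ f) ⟨g, ⟨h0, h⟩, rfl⟩

theorem posFun_le (φ : StrongDual ℝ C(K, ℝ)) {f : C(K, ℝ)} (hf : 0 ≤ f) {c : ℝ}
    (h : ∀ g : C(K, ℝ), 0 ≤ g → g ≤ f → φ g ≤ c) : posFun φ f ≤ c := by
  refine csSup_le ⟨_, 0, ⟨le_rfl, hf⟩, rfl⟩ ?_
  rintro _ ⟨g, hg, rfl⟩
  exact h g hg.1 hg.2

theorem posFun_nonneg (φ : StrongDual ℝ C(K, ℝ)) {f : C(K, ℝ)} (hf : 0 ≤ f) :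
    0 ≤ posFun φ f := by
  simpa using le_posFun φ le_rfl hf

theorem posFun_add (φ : StrongDual ℝ C(K, ℝ)) {f g : C(K, ℝ)} (hf : 0 ≤ f) (hg : 0 ≤ g) :
    posFun φ (f + g) = posFun φ f + posFun φ g := by
  apply le_antisymm
  · refine posFun_le φ (add_nonneg hf hg) fun u hu0 hu => ?_
    have h1 := le_posFun φ (f := f) (g := u ⊓ f) (le_inf hu0 hf) inf_le_right
    have h2 := le_posFun φ (f := g) (g := u - u ⊓ f) (sub_nonneg.mpr inf_le_left) (by
      intro x
      have h1 : u x ≤ f x + g x := hu x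
      have h2 : 0 ≤ g x := hg x
      change u x - min (u x) (f x) ≤ g x
      rcases le_total (u x) (f x) with h | h
      · rw [min_eq_left h]; linarith
      · rw [min_eq_right h]; linarith)
    rw [map_sub] at h2
    linarith
  · rw [← le_sub_iff_add_le]
    refine posFun_le φ hf fun u hu0 hu => ?_
    rw [le_sub_iff_add_le, ← le_sub_iff_add_le']
    refine posFun_le φ hg fun v hv0 hv => ?_
    rw [le_sub_iff_add_le', ← map_add]
    exact le_posFun φ (add_nonneg hu0 hv0) (add_le_add hu hv)

theorem posFun_smul (φ : StrongDual ℝ C(K, ℝ)) {f : C(K, ℝ)} (hf : 0 ≤ f) {c : ℝ}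
    (hc : 0 ≤ c) : posFun φ (c • f) = c * posFun φ f := by
  rcases hc.eq_or_lt with rfl | hc
  · rw [zero_smul, zero_mul]
    refine le_antisymm (posFun_le φ le_rfl fun g h0 h1 => ?_) (posFun_nonneg φ le_rfl)
    rw [le_antisymm h1 h0, map_zero]
  · have key : ∀ {d : ℝ} {u : C(K, ℝ)}, 0 < d → 0 ≤ u → posFun φ (d • u) ≤ d * posFun φ u := by
      intro d u hd hu
      refine posFun_le φ (smul_nonneg hd.le hu) fun g h0 h1 => ?_
      have := le_posFun φ (f := u) (g := d⁻¹ • g) (smul_nonneg (inv_nonneg.mpr hd.le) h0)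
        (by
          have := smul_le_smul_of_nonneg_left h1 (inv_nonneg.mpr hd.le)
          rwa [smul_smul, inv_mul_cancel₀ hd.ne', one_smul] at this)
      rw [map_smul, smul_eq_mul, inv_mul_le_iff₀ hd] at this
      exact this
    refine le_antisymm (key hc hf) ?_
    have := key (inv_pos.mpr hc) (smul_nonneg hc.le hf)
    rw [smul_smul, inv_mul_cancel₀ hc.ne', one_smul, ← div_eq_inv_mul, le_div_iff₀ hc] at this
    linarith

/-- A non-negative real function, from a function with values in `ℝ≥0`. -/
def ofNN (f : C_c(K, ℝ≥0)) : C(K, ℝ) := ⟨fun x => (f x : ℝ), by fun_prop⟩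

theorem ofNN_nonneg (f : C_c(K, ℝ≥0)) : 0 ≤ ofNN f := fun x => (f x).2

theorem ofNN_add (f g : C_c(K, ℝ≥0)) : ofNN (f + g) = ofNN f + ofNN g := by
  ext x; simp [ofNN]

theorem ofNN_smul (c : ℝ≥0) (f : C_c(K, ℝ≥0)) : ofNN (c • f) = (c : ℝ) • ofNN f := by
  ext x; simp [ofNN]

/-- A positively homogeneous, additive, non-negative functional on non-negative continuous
functions is integration against a finite regular measure. -/
theorem exists_measure (p : C(K, ℝ) → ℝ) (h0 : ∀ f, 0 ≤ f → 0 ≤ p f)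
    (hadd : ∀ f g, 0 ≤ f → 0 ≤ g → p (f + g) = p f + p g)
    (hsmul : ∀ (c : ℝ) (f), 0 ≤ c → 0 ≤ f → p (c • f) = c * p f) :
    ∃ m : Measure K, IsFiniteMeasure m ∧ m.Regular ∧ ∀ f : C(K, ℝ), 0 ≤ f → ∫ x, f x ∂m = p f := by
  let L : C_c(K, ℝ≥0) →ₗ[ℝ≥0] ℝ≥0 :=
    { toFun := fun f => ⟨p (ofNN f), h0 _ (ofNN_nonneg f)⟩
      map_add' := fun f g => NNReal.eq (by
        change p (ofNN (f + g)) = p (ofNN f) + p (ofNN g)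
        rw [ofNN_add, hadd _ _ (ofNN_nonneg f) (ofNN_nonneg g)])
      map_smul' := fun c f => NNReal.eq (by
        change p (ofNN (c • f)) = c * p (ofNN f)
        rw [ofNN_smul]
        exact hsmul _ _ c.2 (ofNN_nonneg f)) }
  refine ⟨NNRealRMK.rieszMeasure L, inferInstance, inferInstance, fun f hf => ?_⟩
  let f' : C_c(K, ℝ≥0) :=
    ⟨⟨fun x => (f x).toNNReal, by fun_prop⟩, HasCompactSupport.of_compactSpace _⟩
  have hf' : ofNN f' = f := by
    ext x
    exact Real.coe_toNNReal _ (hf x)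
  have := NNRealRMK.integral_rieszMeasure L f'
  calc ∫ x, f x ∂_ = ∫ x, ofNN f' x ∂(NNRealRMK.rieszMeasure L) := by rw [hf']
    _ = (L f' : ℝ) := this
    _ = p f := by
      change p (ofNN f') = p f
      rw [hf']

theorem toDual_surjective : Function.Surjective (toDual (K := K)) := by
  intro φ
  obtain ⟨m, _, hm, hmp⟩ := exists_measure (posFun φ) (fun f hf => posFun_nonneg φ hf)
    (fun f g hf hg => posFun_add φ hf hg) (fun c f hc hf => posFun_smul φ hf hc)
  obtain ⟨n, _, hn, hnp⟩ := exists_measure (fun f => posFun φ f - φ f)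
    (fun f hf => sub_nonneg.mpr (le_posFun φ hf le_rfl))
    (fun f g hf hg => by rw [posFun_add φ hf hg, map_add]; ring)
    (fun c f hc hf => by rw [posFun_smul φ hf hc, map_smul, smul_eq_mul]; ring)
  refine ⟨ofSub m n hm hn, ?_⟩
  have hpos : ∀ f : C(K, ℝ), 0 ≤ f → toDual (ofSub m n hm hn) f = φ f := by
    intro f hf
    rw [toDual_ofSub, hmp f hf, hnp f hf]
    ring
  ext f
  have hf : f = f ⊔ 0 - (-f) ⊔ 0 := by
    ext x
    simp only [ContinuousMap.sub_apply, ContinuousMap.sup_apply, ContinuousMap.neg_apply,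
      ContinuousMap.zero_apply]
    rcases le_total (f x) 0 with h | h <;> simp [h]
  rw [hf, map_sub, map_sub, hpos _ le_sup_right, hpos _ le_sup_right]

/-- The Riesz representation theorem: `M(K)` is the dual of `C(K)`. -/
def rieszEquiv : RadonMeasure K ≃ₗ[ℝ] StrongDual ℝ C(K, ℝ) :=
  LinearEquiv.ofBijective toDual ⟨toDual_injective, toDual_surjective⟩

/-- The adjoint `T* : M(K) → M(K)` of an operator `T` on `C(K)`. -/
def adjoint (T : C(K, ℝ) →L[ℝ] C(K, ℝ)) : RadonMeasure K →ₗ[ℝ] RadonMeasure K :=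
  rieszEquiv.symm.toLinearMap ∘ₗ
    (ContinuousLinearMap.precomp ℝ T).toLinearMap ∘ₗ rieszEquiv.toLinearMap

theorem integral_adjoint (T : C(K, ℝ) →L[ℝ] C(K, ℝ)) (μ : RadonMeasure K) (f : C(K, ℝ)) :
    ∫ᵛ x, f x ∂<•(adjoint T μ : SignedMeasure K) = ∫ᵛ x, T f x ∂<•(μ : SignedMeasure K) := by
  have h : toDual (adjoint T μ) = (toDual μ).comp T := rieszEquiv.apply_symm_apply _
  exact congrArg (fun φ => φ f) h

/-- The Dirac measure `δ_x ∈ M(K)`. -/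
def dirac (x : K) : RadonMeasure K :=
  ⟨(Measure.dirac x).toSignedMeasure, by
    change (VectorMeasure.variation (Measure.dirac x).toSignedMeasure).Regular
    rw [Measure.variation_toSignedMeasure]
    have : (Measure.dirac x).InnerRegularCompactLTTop := by
      refine ⟨fun A hA r hr => ⟨A ∩ {x}, inter_subset_left, ?_, ?_⟩⟩
      · exact ((finite_singleton x).subset inter_subset_right).isCompact
      · have hxA : x ∈ A := by
          by_contra hx
          simp [Measure.dirac_apply' x hA.1, hx] at hr
        have : A ∩ {x} = {x} := inter_eq_right.mpr (singleton_subset_iff.mpr hxA)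
        rw [this]
        refine hr.trans_le ?_
        simp [Measure.dirac_apply' x hA.1, hxA]
    infer_instance⟩

/-- The signed measure `g μ`, with `(g μ)(E) = ∫_E g dμ` for Borel sets `E`; it is meant for `g`
integrable with respect to `μ`. -/
def mul (g : K → ℝ) (μ : RadonMeasure K) : SignedMeasure K :=
  VectorMeasure.withDensity (μ : SignedMeasure K) g (ContinuousLinearMap.lsmul ℝ ℝ).flip

theorem mul_apply {g : K → ℝ} {μ : RadonMeasure K} (hg : (μ : SignedMeasure K).Integrable g)
    (E : Set K) : mul g μ E = ∫ᵛ x in E, g x ∂<•(μ : SignedMeasure K) :=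
  VectorMeasure.withDensity_apply hg

end RadonMeasure
end RadonMeasures

section Operators

variable {X Y : Type*} [NormedAddCommGroup X] [NormedSpace ℝ X]
  [NormedAddCommGroup Y] [NormedSpace ℝ Y]

/-- A bounded operator is weakly compact if the image of the closed unit ball is relatively
compact in the weak topology. -/
def IsWeaklyCompactOperator (S : X →L[ℝ] Y) : Prop :=
  IsCompact (closure (toWeakSpace ℝ Y '' (S '' Metric.closedBall 0 1)))

/-- The Daugavet equation `‖Id + T‖ = 1 + ‖T‖`. -/
def SatisfiesDaugavetEquation (T : X →L[ℝ] X) : Prop :=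
  ‖ContinuousLinearMap.id ℝ X + T‖ = 1 + ‖T‖

end Operators

end CKDual

end

namespace CKDual

open Filter

/-! ### Gliding hump for sequences of signed measures -/

section Sequences

variable {X : Type*} [MeasurableSpace X] [MeasurableSingletonClass X]

/-! Since `T*δ_x({x}) = g(x) + Sδ_x({x})` and `g ≥ 0`, density follows once `Sδ_x({x}) < 0` for only
countably many `x` (`IsWeaklyCompactOperator.countable_diagonal_neg`), because a perfect compact
Hausdorff space is Baire without isolated points. If `Sδ_x({x}) < -ε` held along distinct points `x
n`, weak compactness would give a setwise cluster point `ρ`. A gliding hump after subtracting `ρ`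
selects a subsequence whose measures are all `≤ -ε/4` on every tail of the selected points starting
no later than their own index; a second cluster point then contradicts countable additivity
(`exists_neg_le_apply_singleton`).

For the Daugavet equation, take `f` in the unit ball with `T f` nearly `‖T‖` on a nonempty open set,
and `x` there with `T*δ_x({x}) ≥ 0`. Raising `f` to `1` near `x` hardly lowers `(T f)(x) = ∫ f
d(T*δ_x)` (`exists_eq_one_integral_gt`), so `Id + T` almost attains `1 + ‖T‖` at `x`. -/

theorem tendsto_measureReal_image_Ici {x : ℕ → X} (hx : Function.Injective x)
    (m : Measure X) [IsFiniteMeasure m] :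
    Tendsto (fun b => m.real (x '' Ici b)) atTop (𝓝 0) := by
  have h := tendsto_measure_iInter_atTop (μ := m) (s := fun b : ℕ => x '' Ici b)
    (fun b => ((to_countable _).image x).measurableSet.nullMeasurableSet)
    (fun a b hab => image_mono (Ici_subset_Ici.2 hab)) ⟨0, measure_ne_top _ _⟩
  have hempty : ⋂ b : ℕ, x '' Ici b = ∅ := by
    refine eq_empty_of_forall_notMem fun y hy => ?_
    rw [mem_iInter] at hy
    obtain ⟨a, -, rfl⟩ := hy 0
    obtain ⟨b, hb, hab⟩ := hy (a + 1)
    rw [hx hab] at hb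
    exact absurd (mem_Ici.1 hb) (by omega)
  rw [hempty, measure_empty] at h
  exact (ENNReal.tendsto_toReal ENNReal.zero_ne_top).comp h

/-- Countable additivity in the form used below. The sets `A b` need not be nested; domination by
the variation of the tails suffices. -/
theorem tendsto_signedMeasure_of_subset_image_Ici {x : ℕ → X} (hx : Function.Injective x)
    (ρ : SignedMeasure X) {A : ℕ → Set X} (hA : ∀ b, A b ⊆ x '' Ici b) :
    Tendsto (fun b => ρ (A b)) atTop (𝓝 0) :=
  squeeze_zero_norm
    (fun b => (VectorMeasure.norm_measure_le_variation).trans (measureReal_mono (hA b)))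
    (tendsto_measureReal_image_Ici hx (VectorMeasure.variation ρ))

/-- The gliding hump: on a tail `{y k, y (k + 1), …}` that contains `y j`, the value of `ν` is
governed by the point `y j` if the earlier points and the later tail are small. -/
theorem signedMeasure_image_Ici_le {y : ℕ → X} (hy : Function.Injective y) (ν : SignedMeasure X)
    {j k : ℕ} (hkj : k ≤ j) {δ : ℝ} (hearly : ∀ i < j, ν {y i} ≤ δ * (1 / 2) ^ i) (hδ : 0 ≤ δ)
    (hlate : (VectorMeasure.variation ν).real (y '' Ioi j) ≤ δ) :
    ν (y '' Ici k) ≤ ν {y j} + 3 * δ := by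
  have hmeas : ∀ s : Set ℕ, MeasurableSet (y '' s) :=
    fun s => ((to_countable s).image y).measurableSet
  have hsplit : Ici k = Ico k j ∪ ({j} ∪ Ioi j) := by
    ext i; simp only [mem_Ici, mem_union, mem_Ico, mem_singleton_iff, mem_Ioi]; omega
  have hd1 : Disjoint (y '' Ico k j) (y '' ({j} ∪ Ioi j)) := by
    rw [disjoint_image_iff hy, Set.disjoint_left]
    intro i; simp only [mem_union, mem_Ico, mem_singleton_iff, mem_Ioi]; omega
  have hd2 : Disjoint (y '' {j}) (y '' Ioi j) := by
    rw [disjoint_image_iff hy, Set.disjoint_left]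
    intro i; simp only [mem_singleton_iff, mem_Ioi]; omega
  rw [hsplit, image_union, VectorMeasure.of_union hd1 (hmeas _) (hmeas _), image_union,
    VectorMeasure.of_union hd2 (hmeas _) (hmeas _), image_singleton]
  -- The geometric weights sum to at most `2`; the late tail costs one more `δ`.
  have h1 : ν (y '' Ico k j) ≤ 2 * δ := by
    have hU : y '' Ico k j = ⋃ i ∈ Finset.Ico k j, {y i} := by
      ext z; simp [eq_comm]
    rw [hU, VectorMeasure.of_biUnion_finset
      (fun a _ b _ hab => disjoint_singleton.2 (hy.ne hab)) (fun _ _ => measurableSet_singleton _)]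
    calc ∑ i ∈ Finset.Ico k j, ν {y i} ≤ ∑ i ∈ Finset.Ico k j, δ * (1 / 2) ^ i :=
          Finset.sum_le_sum fun i hi => hearly i (Finset.mem_Ico.1 hi).2
      _ ≤ ∑ i ∈ Finset.range j, δ * (1 / 2) ^ i :=
          Finset.sum_le_sum_of_subset_of_nonneg
            (fun i hi => Finset.mem_range.2 (Finset.mem_Ico.1 hi).2) fun _ _ _ => by positivity
      _ ≤ 2 * δ := by
          rw [← Finset.mul_sum]
          nlinarith [sum_geometric_two_le j]
  have h3 : ν (y '' Ioi j) ≤ δ :=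
    (le_abs_self _).trans ((VectorMeasure.norm_measure_le_variation).trans hlate)
  linarith

/-- If every subsequence of `μ` has a setwise cluster point, then the diagonal values
`μ n {x n}` cannot stay away from zero. -/
theorem exists_neg_le_apply_singleton (μ : ℕ → SignedMeasure X) {x : ℕ → X}
    (hx : Function.Injective x)
    (hμ : ∀ φ : ℕ → ℕ, ∃ ρ : SignedMeasure X, ∀ B : Set X, MeasurableSet B →
      Tendsto (fun n => μ (φ n) B) (hyperfilter ℕ) (𝓝 (ρ B))) {ε : ℝ} (hε : 0 < ε) :
    ∃ n, -ε ≤ μ n {x n} := by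
  by_contra! hneg
  have hle : (hyperfilter ℕ : Filter ℕ) ≤ atTop := Nat.hyperfilter_le_atTop
  obtain ⟨ρ, hρ⟩ := hμ id
  set ν : ℕ → SignedMeasure X := fun n => μ n - ρ with hν
  have hνapply : ∀ n B, ν n B = μ n B - ρ B := fun n B => rfl
  -- Chosen so that the hump error `3 * δ` is `ε / 4`, half of the diagonal bound `ε / 2`.
  set δ : ℝ := ε / 12 with hδ
  have hδpos : 0 < δ := by positivity
  have hdiag : ∀ᶠ n in (hyperfilter ℕ : Filter ℕ), ν n {x n} < -(ε / 2) := by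
    have ht : Tendsto (fun n => ρ {x n}) atTop (𝓝 0) :=
      tendsto_signedMeasure_of_subset_image_Ici hx ρ
        fun b => singleton_subset_iff.2 (mem_image_of_mem x self_mem_Ici)
    filter_upwards [hle (ht.eventually (lt_mem_nhds (show -(ε / 2) < 0 by linarith)))] with n hn
    rw [hνapply]
    linarith [hneg n]
  -- For fixed `a` this holds for ultrafilter-many `b`, so the conditions from finitely many earlier
  -- indices can be met at once.
  have hrel : ∀ a, ∀ᶠ b in (hyperfilter ℕ : Filter ℕ), a < b ∧ ν b {x a} < δ * (1 / 2) ^ a ∧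
      (VectorMeasure.variation (ν a)).real (x '' Ici b) < δ := by
    intro a
    have h1 : Tendsto (fun b => ν b {x a}) (hyperfilter ℕ) (𝓝 0) := by
      simpa [hνapply] using (hρ {x a} (measurableSet_singleton _)).sub_const (ρ {x a})
    exact ((eventually_gt_atTop a).filter_mono hle).and ((h1.eventually (gt_mem_nhds (by positivity))).and
      (((tendsto_measureReal_image_Ici hx _).eventually (gt_mem_nhds hδpos)).filter_mono hle))
  obtain ⟨f, hfP, hfr⟩ := exists_seq_of_forall_finset_exists (fun n => ν n {x n} < -(ε / 2))
    (fun a b => a < b ∧ ν b {x a} < δ * (1 / 2) ^ a ∧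
      (VectorMeasure.variation (ν a)).real (x '' Ici b) < δ)
    fun s _ => (hdiag.and ((eventually_all_finset s).2 fun a _ => hrel a)).exists
  have hf : StrictMono f := fun m n hmn => (hfr m n hmn).1
  have hy : Function.Injective (x ∘ f) := hx.comp hf.injective
  have hhump : ∀ k j, k ≤ j → ν (f j) ((x ∘ f) '' Ici k) ≤ -(ε / 4) := by
    intro k j hkj
    -- The construction gives the weight `(1 / 2) ^ f i`, and `i ≤ f i`. The points after `y j` lie
    -- in the tail of `x` from `f (j + 1)`, whose variation was made small.
    have := signedMeasure_image_Ici_le hy (ν (f j)) hkj (δ := δ) (fun i hi =>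
      (hfr i j hi).2.1.le.trans (mul_le_mul_of_nonneg_left
        (pow_le_pow_of_le_one (by norm_num) (by norm_num) (hf.id_le i)) hδpos.le)) hδpos.le
      ((measureReal_mono (by
        rw [image_comp]
        refine image_mono ?_
        rintro _ ⟨i, hi, rfl⟩
        exact hf.monotone (Nat.succ_le_of_lt hi))).trans (hfr j (j + 1) j.lt_succ_self).2.2.le)
    have h2 := hfP j
    change _ ≤ ν (f j) {x (f j)} + 3 * δ at this
    linarith
  -- The subsequence may cluster elsewhere, so `ρ'` need not equal `ρ`; `ρ' - ρ` is still countably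
  -- additive, which is enough.
  obtain ⟨ρ', hρ'⟩ := hμ f
  have hlim : ∀ k, (ρ' - ρ) ((x ∘ f) '' Ici k) ≤ -(ε / 4) := fun k =>
    le_of_tendsto
      ((hρ' _ ((to_countable (Ici k)).image (x ∘ f)).measurableSet).sub_const (ρ ((x ∘ f) '' Ici k)))
      (hle ((eventually_ge_atTop k).mono fun j hj => hhump k j hj))
  have := le_of_tendsto' (tendsto_signedMeasure_of_subset_image_Ici hy (ρ' - ρ)
    fun b => Subset.rfl) hlim
  linarith

end Sequences

/-! ### Weak compactness and the diagonal of `S` -/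

section Diagonal

variable {K : Type*} [TopologicalSpace K] [CompactSpace K] [T2Space K]
  [MeasurableSpace K] [BorelSpace K]

namespace RadonMeasure

/-- Evaluation of Radon measures at a set, as a bounded functional. -/
noncomputable def evalSet (B : Set K) : StrongDual ℝ (RadonMeasure K) :=
  LinearMap.mkContinuous
    { toFun := fun μ => (μ : SignedMeasure K) B
      map_add' := fun _ _ => rfl
      map_smul' := fun _ _ => rfl } 1 fun μ => by
    rw [one_mul]
    exact (VectorMeasure.norm_measure_le_variation).trans (measureReal_mono (subset_univ B))

theorem coe_dirac (x : K) :
    (dirac x : SignedMeasure K) = (Measure.dirac x).toSignedMeasure := rfl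

theorem norm_dirac (x : K) : ‖dirac x‖ = 1 := by
  rw [norm_def, coe_dirac, Measure.variation_toSignedMeasure]
  simp

theorem integral_dirac (x : K) (f : K → ℝ) :
    ∫ᵛ y, f y ∂<•(dirac x : SignedMeasure K) = f x := by
  rw [coe_dirac, VectorMeasure.integral_toSignedMeasure, MeasureTheory.integral_dirac]

theorem mul_dirac_singleton {g : K → ℝ} {x : K} (hg : (dirac x : SignedMeasure K).Integrable g) :
    mul g (dirac x) {x} = g x := by
  rw [mul_apply hg, VectorMeasure.integral_singleton, coe_dirac,
    Measure.toSignedMeasure_apply_measurable (measurableSet_singleton x)]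
  simp [measureReal_def]

end RadonMeasure

open RadonMeasure

/-- A bounded sequence has a subnet whose image under a weakly compact operator into `M(K)`
converges setwise. -/
theorem IsWeaklyCompactOperator.exists_tendsto_setwise {X : Type*} [NormedAddCommGroup X]
    [NormedSpace ℝ X] {S : X →L[ℝ] RadonMeasure K} (hS : IsWeaklyCompactOperator S)
    {ι : Type*} (l : Ultrafilter ι) {u : ι → X} (hu : ∀ n, ‖u n‖ ≤ 1) :
    ∃ ρ : RadonMeasure K, ∀ B : Set K,
      Tendsto (fun n => (S (u n) : SignedMeasure K) B) l (𝓝 ((ρ : SignedMeasure K) B)) := by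
  let w : ι → WeakSpace ℝ (RadonMeasure K) := fun n => toWeakSpace ℝ _ (S (u n))
  obtain ⟨ρ, -, hρ⟩ := hS.ultrafilter_le_nhds (l.map w) (by
    rw [le_principal_iff]
    refine mem_map.2 (Eventually.of_forall fun n => subset_closure ?_)
    exact mem_image_of_mem _ (mem_image_of_mem _ (mem_closedBall_zero_iff.2 (hu n))))
  refine ⟨(toWeakSpace ℝ _).symm ρ, fun B => ?_⟩
  -- Evaluation at `B` is a bounded functional, hence weakly continuous.
  exact ((WeakBilin.eval_continuous _ (evalSet B)).tendsto ρ).comp hρ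

/-- For a weakly compact operator `S` on `M(K)`, the diagonal `x ↦ S(δ_x)({x})` is negative at
only countably many points. -/
theorem IsWeaklyCompactOperator.countable_diagonal_neg
    {S : RadonMeasure K →L[ℝ] RadonMeasure K} (hS : IsWeaklyCompactOperator S) :
    {x : K | (S (dirac x) : SignedMeasure K) {x} < 0}.Countable := by
  have hfin : ∀ n : ℕ,
      {x : K | (S (dirac x) : SignedMeasure K) {x} < -(1 / ((n : ℝ) + 1))}.Finite := by
    intro n
    by_contra hinf
    let x := Set.Infinite.natEmbedding _ hinf
    obtain ⟨k, hk⟩ := exists_neg_le_apply_singleton (fun k => (S (dirac (x k).1)).1)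
      (x := fun k => (x k).1) (Subtype.val_injective.comp x.injective)
      (fun φ => by
        obtain ⟨ρ, hρ⟩ := hS.exists_tendsto_setwise (hyperfilter ℕ)
          (u := fun k => dirac (x (φ k)).1) fun k => (norm_dirac _).le
        exact ⟨ρ, fun B _ => hρ B⟩) (ε := 1 / ((n : ℝ) + 1)) (by positivity)
    exact absurd (x k).2 (not_lt.2 hk)
  refine (countable_iUnion fun n => (hfin n).countable).mono fun x hx => ?_
  obtain ⟨n, hn⟩ := exists_nat_one_div_lt (neg_pos.2 (mem_ofPred_eq ▸ hx))
  exact mem_iUnion.2 ⟨n, by rw [mem_ofPred_eq]; linarith⟩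

end Diagonal

/-! ### Density and the Daugavet equation -/

section Daugavet

variable {K : Type*} [TopologicalSpace K] [CompactSpace K] [T2Space K]
  [MeasurableSpace K] [BorelSpace K]

open RadonMeasure

/-- Baire category: without isolated points, the complement of each point is open and dense. -/
theorem _root_.Set.Countable.dense_compl_of_perfectSpace {X : Type*} [TopologicalSpace X]
    [BaireSpace X] [T1Space X] [PerfectSpace X] {s : Set X} (hs : s.Countable) : Dense sᶜ := by
  have : sᶜ = ⋂ x ∈ s, ({x}ᶜ : Set X) := by
    ext x
    simp only [mem_compl_iff, mem_iInter, mem_singleton_iff]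
    exact ⟨fun h i hi hxi => h (hxi ▸ hi), fun h hx => h x hx rfl⟩
  rw [this]
  refine dense_biInter_of_isOpen (fun _ _ => isOpen_compl_singleton) hs fun x _ => ?_
  have := perfectSpace_iff_forall_not_isolated.1 ‹PerfectSpace X› x
  exact dense_compl_singleton x

/-- A function in the unit ball can be changed to have value `1` at a point of non-negative mass
without decreasing its integral by more than `ε`. -/
theorem exists_eq_one_integral_gt (μ : RadonMeasure K) {x : K}
    (hx : 0 ≤ (μ : SignedMeasure K) {x}) {f : C(K, ℝ)} (hf : ‖f‖ ≤ 1) {ε : ℝ} (hε : 0 < ε) :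
    ∃ h : C(K, ℝ), ‖h‖ ≤ 1 ∧ h x = 1 ∧
      ∫ᵛ y, f y ∂<•(μ : SignedMeasure K) - ε ≤ ∫ᵛ y, h y ∂<•(μ : SignedMeasure K) := by
  set m := VectorMeasure.variation (μ : SignedMeasure K) with hm
  have hreg : m.Regular := μ.2
  obtain ⟨V, hxV, hVo, hV⟩ := ({x} : Set K).exists_isOpen_lt_add (μ := m) (measure_ne_top _ _)
    (ε := ENNReal.ofReal (ε / 2)) (by simpa using hε)
  have hVx : m.real (V \ {x}) ≤ ε / 2 := by
    rw [measureReal_sdiff hxV (measurableSet_singleton x), sub_le_iff_le_add',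
      measureReal_def, measureReal_def, ← ENNReal.toReal_ofReal (show 0 ≤ ε / 2 by positivity),
      ← ENNReal.toReal_add (measure_ne_top _ _) ENNReal.ofReal_ne_top]
    exact ENNReal.toReal_mono (by finiteness) hV.le
  obtain ⟨u, hu0, hu1, hu⟩ := exists_continuous_zero_one_of_isClosed hVo.isClosed_compl
    (isClosed_singleton (x := x)) (disjoint_compl_left_iff_subset.2 hxV)
  have hfb : ∀ y, -1 ≤ f y ∧ f y ≤ 1 := fun y => abs_le.1 ((f.norm_coe_le_norm y).trans hf)
  have hux : u x = 1 := hu1 (mem_singleton x)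
  -- `f + d = (1 - u) f + u` is a pointwise convex combination of `f` and `1`, so it stays in the
  -- unit ball.
  set d : C(K, ℝ) := u * (1 - f) with hd
  have hdapply : ∀ y, d y = u y * (1 - f y) := fun y => rfl
  refine ⟨f + d, ?_, ?_, ?_⟩
  · rw [ContinuousMap.norm_le _ zero_le_one]
    intro y
    rw [Real.norm_eq_abs, abs_le, ContinuousMap.add_apply, hdapply]
    have h1 := hfb y
    have h2 := hu y
    constructor <;> nlinarith [h2.1, h2.2]
  · rw [ContinuousMap.add_apply, hdapply, hux]; ring
  · have hdi := integrable_continuous (μ : SignedMeasure K) d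
    have hadd : ∫ᵛ y, (f + d) y ∂<•(μ : SignedMeasure K) =
        ∫ᵛ y, f y ∂<•(μ : SignedMeasure K) + ∫ᵛ y, d y ∂<•(μ : SignedMeasure K) :=
      VectorMeasure.integral_fun_add (integrable_continuous _ f) hdi
    -- The part of `d` at `x` contributes `(1 - f x) μ({x}) ≥ 0`. The rest is bounded by `2` and
    -- lives on `V \ {x}`, of variation at most `ε / 2`.
    set c : K → ℝ := ({x} : Set K).indicator fun _ => d x with hc
    have hci : (μ : SignedMeasure K).Integrable c :=
      (integrable_const (d x)).indicator (μ := m) (measurableSet_singleton x)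
    have hcint : ∫ᵛ y, c y ∂<•(μ : SignedMeasure K) = (1 - f x) * (μ : SignedMeasure K) {x} := by
      rw [hc, VectorMeasure.integral_indicator_const _ (measurableSet_singleton x), hdapply, hux]
      simp [mul_comm]
    have hsub : ‖∫ᵛ y, (d y - c y) ∂<•(μ : SignedMeasure K)‖ ≤ ε := by
      refine VectorMeasure.norm_integral_le_integral_norm.trans ?_
      rw [ContinuousLinearMap.opNorm_flip, ContinuousLinearMap.opNorm_lsmul, one_mul]
      have hmV : MeasurableSet (V \ {x}) := hVo.measurableSet.diff (measurableSet_singleton x)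
      calc ∫ y, ‖d y - c y‖ ∂m ≤ ∫ y, (V \ {x}).indicator (fun _ => (2 : ℝ)) y ∂m := by
            refine integral_mono (hdi.sub hci).norm ((integrable_const _).indicator hmV) fun y => ?_
            by_cases hyx : y = x
            · simp [hc, hyx]
            · by_cases hyV : y ∈ V
              · have h1 := hfb y
                have h2 := hu y
                simp only [hc, mem_singleton_iff, hyx, not_false_eq_true, indicator_of_notMem,
                  sub_zero, Set.indicator_of_mem (show y ∈ V \ {x} from ⟨hyV, hyx⟩),
                  Real.norm_eq_abs, hdapply, abs_le]
                constructor <;> nlinarith [h2.1, h2.2]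
              · have : u y = 0 := hu0 hyV
                simp [hc, hyx, hyV, hdapply, this]
        _ = 2 * m.real (V \ {x}) := by
            rw [integral_indicator_const _ hmV, smul_eq_mul, mul_comm]
        _ ≤ ε := by linarith
    rw [VectorMeasure.integral_fun_sub hdi hci, hcint, Real.norm_eq_abs] at hsub
    have := mul_nonneg (sub_nonneg.2 (hfb x).2) hx
    rw [hadd]
    linarith [(abs_le.1 hsub).1]

/-- If `T*(δ_x)({x}) ≥ 0` for a dense set of points `x`, then `T` satisfies the Daugavet
equation. -/
theorem satisfiesDaugavetEquation_of_dense (T : C(K, ℝ) →L[ℝ] C(K, ℝ)) [Nonempty K]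
    (hT : Dense {x : K | 0 ≤ (adjoint T (dirac x) : SignedMeasure K) {x}}) :
    SatisfiesDaugavetEquation T := by
  refine le_antisymm ((norm_add_le _ _).trans_eq (by rw [ContinuousLinearMap.norm_id])) ?_
  refine le_of_forall_pos_le_add fun ε hε => ?_
  obtain ⟨f, hf1, hf⟩ : ∃ f : C(K, ℝ), ‖f‖ < 1 ∧ ‖T‖ - ε / 2 < ‖T f‖ :=
    T.exists_lt_apply_of_lt_opNorm (by linarith)
  -- Replacing `f` by `-f` if necessary removes the absolute value.
  obtain ⟨f, y, hf1, hy⟩ : ∃ (f : C(K, ℝ)) (y : K), ‖f‖ ≤ 1 ∧ ‖T‖ - ε / 2 < T f y := by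
    obtain ⟨y, hy⟩ : ∃ y, ‖T‖ - ε / 2 < ‖T f y‖ := by
      by_contra! h
      exact hf.not_ge ((ContinuousMap.norm_le_of_nonempty _).2 h)
    rcases lt_abs.1 hy with h | h
    · exact ⟨f, y, hf1.le, h⟩
    · exact ⟨-f, y, by rw [norm_neg]; exact hf1.le, by simpa using h⟩
  obtain ⟨x, hx, hxpos⟩ := hT.inter_open_nonempty {y | ‖T‖ - ε / 2 < T f y}
    (isOpen_lt continuous_const (T f).continuous) ⟨y, hy⟩
  obtain ⟨h, hh1, hhx, hh⟩ := exists_eq_one_integral_gt _ hxpos hf1 (half_pos hε)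
  rw [integral_adjoint, integral_adjoint, RadonMeasure.integral_dirac,
    RadonMeasure.integral_dirac] at hh
  have hx : ‖T‖ - ε / 2 < T f x := hx
  have hval : 1 + T h x ≤ ‖ContinuousLinearMap.id ℝ C(K, ℝ) + T‖ := by
    calc 1 + T h x = (ContinuousLinearMap.id ℝ C(K, ℝ) + T) h x := by simp [hhx]
      _ ≤ ‖(ContinuousLinearMap.id ℝ C(K, ℝ) + T) h‖ :=
        (le_abs_self _).trans (ContinuousMap.norm_coe_le_norm
          ((ContinuousLinearMap.id ℝ C(K, ℝ) + T) h) x)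
      _ ≤ _ := ContinuousLinearMap.unit_le_opNorm _ h hh1
  linarith

end Daugavet

end CKDual

theorem mainTheorem6 {K : Type*} [TopologicalSpace K] [CompactSpace K] [T2Space K]
    [PerfectSpace K] [Nonempty K] [MeasurableSpace K] [BorelSpace K]
    (T : C(K, ℝ) →L[ℝ] C(K, ℝ))
    (g : K → ℝ) (hg_borel : Measurable g) (hg_nonneg : ∀ x, 0 ≤ g x)
    (hg_int : ∀ μ : CKDual.RadonMeasure K, (μ : SignedMeasure K).Integrable g)
    (S : CKDual.RadonMeasure K →L[ℝ] CKDual.RadonMeasure K)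
    (hS : CKDual.IsWeaklyCompactOperator S)
    (hT : ∀ μ : CKDual.RadonMeasure K,
      (CKDual.RadonMeasure.adjoint T μ : SignedMeasure K) =
        CKDual.RadonMeasure.mul g μ + (S μ : SignedMeasure K)) :
    Dense {x : K | 0 ≤ (CKDual.RadonMeasure.adjoint T (CKDual.RadonMeasure.dirac x) :
      SignedMeasure K) {x}} ∧
    CKDual.SatisfiesDaugavetEquation T := by
  have hdense : Dense {x : K | 0 ≤ (CKDual.RadonMeasure.adjoint T (CKDual.RadonMeasure.dirac x) :
      SignedMeasure K) {x}} := by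
    refine hS.countable_diagonal_neg.dense_compl_of_perfectSpace.mono fun x hx => ?_
    rw [mem_compl_iff, mem_ofPred_eq, not_lt] at hx
    rw [mem_ofPred_eq, hT, add_apply, CKDual.RadonMeasure.mul_dirac_singleton (hg_int _)]
    exact add_nonneg (hg_nonneg x) hx
  exact ⟨hdense, CKDual.satisfiesDaugavetEquation_of_dense T hdense⟩
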